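/- For a finite group $G$ with centre $Z(G)$, let $\Pr(G)=\dfrac{|\{(x,y)\in G\times G : xy=yx\}|}{|G|^2}$ be its commutativity degree, and let the commuting graph $\Gamma_G$ be the simple graph with vertex set $G\setminus Z(G)$ in which two distinct vertices $x,y$ are adjacent if and only if $xy=yx$. Let $A$ be the adjacency matrix and $D$ the diagonal degree matrix of $\Gamma_G$. The group $G$ is called super integral if it is non-abelian and all eigenvalues of the adjacency matrix $A$, of the Laplacian matrix $D-A$ and of the signless Laplacian matrix $D+A$ are integers. Theorem. Let $G$ be a finite group. If $\Pr(G)\in\left\{\frac{5}{14},\frac{2}{5},\frac{11}{27},\frac{1}{2},\frac{5}{8}\right\}$, then $G$ is super integral. -/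

import Mathlib

namespace SuperIntegral

section Graph

open Classical in
/-- The signless Laplacian matrix `D + A` of a finite graph, over `ℂ`. -/
noncomputable def signlessLapMatrix {V : Type*} [Fintype V] (Γ : SimpleGraph V) : Matrix V V ℂ :=
  Γ.degMatrix ℂ + Γ.adjMatrix ℂ

open Classical in
/-- The spectrum of a finite graph: the eigenvalues of the adjacency matrix, with multiplicities. -/
noncomputable def adjSpec {V : Type*} [Fintype V] (Γ : SimpleGraph V) : Multiset ℂ :=
  (Γ.adjMatrix ℂ).charpoly.roots

open Classical in
/-- The Laplacian spectrum of a finite graph: the eigenvalues of `D - A`, with multiplicities. -/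
noncomputable def lapSpec {V : Type*} [Fintype V] (Γ : SimpleGraph V) : Multiset ℂ :=
  (Γ.lapMatrix ℂ).charpoly.roots

open Classical in
/-- The signless Laplacian spectrum of a finite graph: the eigenvalues of `D + A`, with
multiplicities. -/
noncomputable def signlessLapSpec {V : Type*} [Fintype V] (Γ : SimpleGraph V) : Multiset ℂ :=
  (signlessLapMatrix Γ).charpoly.roots

/-- The graph is integral: its spectrum contains only integers. -/
def IsIntegralGraph {V : Type*} [Fintype V] (Γ : SimpleGraph V) : Prop :=
  ∀ μ ∈ adjSpec Γ, ∃ k : ℤ, μ = k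

/-- The graph is L-integral: its Laplacian spectrum contains only integers. -/
def IsLIntegralGraph {V : Type*} [Fintype V] (Γ : SimpleGraph V) : Prop :=
  ∀ μ ∈ lapSpec Γ, ∃ k : ℤ, μ = k

/-- The graph is Q-integral: its signless Laplacian spectrum contains only integers. -/
def IsQIntegralGraph {V : Type*} [Fintype V] (Γ : SimpleGraph V) : Prop :=
  ∀ μ ∈ signlessLapSpec Γ, ∃ k : ℤ, μ = k

end Graph

/-- The commuting graph of a group `G`: the vertices are the non-central elements, and two distinct
vertices are adjacent if and only if they commute. -/
def commutingGraph (G : Type*) [Group G] : SimpleGraph {x : G // x ∉ Subgroup.center G} where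
  Adj x y := x ≠ y ∧ (x : G) * y = y * x
  symm := ⟨fun _ _ h => ⟨h.1.symm, h.2.symm⟩⟩
  loopless := ⟨fun _ h => h.1 rfl⟩

open Classical in
/-- A finite group is super integral if it is non-abelian and its commuting graph is integral,
L-integral and Q-integral. -/
def IsSuperIntegral (G : Type*) [Group G] [Fintype G] : Prop :=
  (∃ a b : G, a * b ≠ b * a) ∧
    IsIntegralGraph (commutingGraph G) ∧
    IsLIntegralGraph (commutingGraph G) ∧
    IsQIntegralGraph (commutingGraph G)

end SuperIntegral

/-!
Two ideas carry the proof.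

The first is that the three spectra are visibly integral as soon as commuting is transitive on the
non-central elements: the commuting graph is then a disjoint union of cliques, and on a clique of
degree `d` each of `A`, `D - A`, `D + A` has the form `a I + b J` with integers `a`, `b`
(`SuperIntegral.isSuperIntegral_of_commute_trans`).

The second is that a large commutativity degree forces a small derived subgroup. By Maschke and
Wedderburn the complex group algebra is a product of matrix algebras, one for each conjugacy class,
and at most `[G : G']` of them are one-dimensional; counting dimensions gives
`4 k(G) ≤ |G| + 3 [G : G']` (`four_mul_card_conjClasses_le`), that is
`Pr(G) ≤ 1/4 + 3 / (4 |G'|)`. As all the given values are at least `5/14`, this leaves `|G'| ≤ 7`.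

The orders `4` and `6` are excluded by divisibility. The number `Pr(G) [G : Z(G)]²` is an integer,
while the prime divisors of `[G : Z(G)]` are controlled by `G'`: the quotient `G / C(G')` acts
faithfully on `G'`, and `C(G') / Z(G)` has exponent dividing `|G'|` because `x ↦ [g, x]` respects
powers on `C(G')` (`exists_index_center_eq_mul`). The denominators `14`, `5` and `27` do not fit.

So `|G'| = p` is prime. If `G'` is not central, then `C(G')` is abelian, and commuting is transitive
on non-central elements whatever `Pr(G)` is (`commute_trans_of_not_commutator_le_center`). If `G'`
is central, all non-central classes have size `p`, so `Pr(G)` determines `[G : Z(G)]`, which for the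
given values is `p²`; each centralizer of a non-central element is then of index `p` over the centre
and hence abelian (`commute_trans_of_index_centralizer`).
-/

open scoped Matrix commutatorElement

/-! ### Spectra of disjoint unions of complete graphs -/

/-- A complex root of the characteristic polynomial of a matrix has an eigenvector. -/
lemma Matrix.exists_mulVec_eq_smul_of_mem_roots_charpoly {V K : Type*} [Fintype V] [DecidableEq V]
    [Field K] {M : Matrix V V K} {μ : K} (h : μ ∈ M.charpoly.roots) :
    ∃ v : V → K, v ≠ 0 ∧ M *ᵥ v = μ • v := by
  have h1 := (Polynomial.mem_roots'.1 h).2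
  rw [Polynomial.IsRoot.def, Matrix.eval_charpoly] at h1
  obtain ⟨v, hv, hv'⟩ := Matrix.exists_mulVec_eq_zero_iff.2 h1
  refine ⟨v, hv, ?_⟩
  rw [Matrix.sub_mulVec, sub_eq_zero, Matrix.scalar_apply] at hv'
  rw [← hv']
  ext i
  simp [Matrix.mulVec_diagonal]

section CliqueUnion

variable {V : Type*} [Fintype V] [DecidableEq V] {Γ : SimpleGraph V} [DecidableRel Γ.Adj]

lemma SimpleGraph.insert_neighborFinset_eq_of_adj
    (hΓ : ∀ x y z, Γ.Adj x y → Γ.Adj y z → x ≠ z → Γ.Adj x z) {x y : V} (hxy : Γ.Adj x y) :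
    insert x (Γ.neighborFinset x) = insert y (Γ.neighborFinset y) := by
  ext z
  simp only [Finset.mem_insert, SimpleGraph.mem_neighborFinset]
  constructor
  · rintro (rfl | h)
    · exact Or.inr hxy.symm
    · by_cases hz : z = y
      · exact Or.inl hz
      · exact Or.inr (hΓ _ _ _ hxy.symm h (Ne.symm hz))
  · rintro (rfl | h)
    · exact Or.inr hxy
    · by_cases hz : z = x
      · exact Or.inl hz
      · exact Or.inr (hΓ _ _ _ hxy h (Ne.symm hz))

/-- If adjacency is transitive, each component of the graph is a clique, so `α D + β A` acts on it
as `(α d - β) I + β J` with `d` constant and `J` the all-ones matrix of size `d + 1`. Its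
eigenvalues are therefore `(α + β) d` and `α d - β`. -/
lemma SimpleGraph.exists_int_eq_of_mulVec_eq_smul
    (hΓ : ∀ x y z, Γ.Adj x y → Γ.Adj y z → x ≠ z → Γ.Adj x z) (α β : ℤ) {v : V → ℂ}
    (hv : v ≠ 0) {μ : ℂ}
    (h : ∀ x, α * (Γ.degree x * v x) + β * ∑ y ∈ Γ.neighborFinset x, v y = μ * v x) :
    ∃ k : ℤ, μ = k := by
  set K : V → Finset V := fun x => insert x (Γ.neighborFinset x) with hK
  have hKeq : ∀ x, ∀ y ∈ K x, K y = K x := by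
    intro x y hy
    rcases Finset.mem_insert.1 hy with rfl | hy
    · rfl
    · exact (insert_neighborFinset_eq_of_adj hΓ ((Γ.mem_neighborFinset x y).1 hy)).symm
  have hcard : ∀ x, (K x).card = Γ.degree x + 1 := fun x => by
    rw [hK, Finset.card_insert_of_notMem (by simp), SimpleGraph.card_neighborFinset_eq_degree]
  have hsum : ∀ x, ∑ y ∈ K x, v y = v x + ∑ y ∈ Γ.neighborFinset x, v y := fun x => by
    rw [hK, Finset.sum_insert (by simp)]
  have key : ∀ x, (μ - α * Γ.degree x + β) * v x = β * ∑ y ∈ K x, v y := fun x => by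
    rw [hsum]; linear_combination -(h x)
  by_cases hS : ∀ x, ∑ y ∈ K x, v y = 0
  · obtain ⟨x, hx⟩ := Function.ne_iff.1 hv
    have := key x
    rw [hS, mul_zero] at this
    have := (mul_eq_zero.1 this).resolve_right hx
    exact ⟨α * Γ.degree x - β, by push_cast; linear_combination this⟩
  · push Not at hS
    obtain ⟨x, hx⟩ := hS
    -- summing the eigenvalue equation over the clique of `x`
    have h1 : ∑ y ∈ K x, (μ - α * Γ.degree x + β) * v y
        = ∑ y ∈ K x, β * ∑ z ∈ K x, v z := by
      refine Finset.sum_congr rfl fun y hy => ?_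
      have hd : Γ.degree y = Γ.degree x := by
        have := congrArg Finset.card (hKeq x y hy)
        rw [hcard, hcard] at this
        omega
      rw [← hd, key y, hKeq x y hy]
    rw [← Finset.mul_sum, Finset.sum_const, nsmul_eq_mul, hcard, ← mul_assoc] at h1
    have h2 := mul_right_cancel₀ hx h1
    push_cast at h2
    exact ⟨(α + β) * Γ.degree x, by push_cast; linear_combination h2⟩

end CliqueUnion

namespace SuperIntegral

open Classical in
lemma isIntegral_of_adj_trans {V : Type*} [Fintype V] {Γ : SimpleGraph V}
    (hΓ : ∀ x y z, Γ.Adj x y → Γ.Adj y z → x ≠ z → Γ.Adj x z) :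
    IsIntegralGraph Γ ∧ IsLIntegralGraph Γ ∧ IsQIntegralGraph Γ := by
  refine ⟨fun μ hμ => ?_, fun μ hμ => ?_, fun μ hμ => ?_⟩ <;>
    obtain ⟨v, hv, hv'⟩ := Matrix.exists_mulVec_eq_smul_of_mem_roots_charpoly hμ
  · refine Γ.exists_int_eq_of_mulVec_eq_smul hΓ 0 1 hv fun x => ?_
    have := congrFun hv' x
    rw [SimpleGraph.adjMatrix_mulVec_apply, Pi.smul_apply, smul_eq_mul] at this
    simpa using this
  · refine Γ.exists_int_eq_of_mulVec_eq_smul hΓ 1 (-1) hv fun x => ?_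
    have := congrFun hv' x
    rw [SimpleGraph.lapMatrix_mulVec_apply, Pi.smul_apply, smul_eq_mul] at this
    rw [← this]
    push_cast
    ring
  · refine Γ.exists_int_eq_of_mulVec_eq_smul hΓ 1 1 hv fun x => ?_
    have := congrFun hv' x
    rw [signlessLapMatrix, Matrix.add_mulVec, Pi.add_apply, SimpleGraph.degMatrix_mulVec_apply,
      SimpleGraph.adjMatrix_mulVec_apply, Pi.smul_apply, smul_eq_mul] at this
    simpa using this

open Classical in
/-- If commuting is transitive on the non-central elements, the commuting graph is a disjoint union
of complete graphs. -/
lemma isSuperIntegral_of_commute_trans (G : Type*) [Group G] [Fintype G]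
    (hG : ∃ a b : G, a * b ≠ b * a)
    (h : ∀ y ∉ Subgroup.center G, ∀ x z : G, Commute x y → Commute y z → Commute x z) :
    IsSuperIntegral G :=
  ⟨hG, isIntegral_of_adj_trans fun x y z hxy hyz hxz =>
    ⟨hxz, h y y.2 x z hxy.2 hyz.2⟩⟩

end SuperIntegral

/-! ### The number of conjugacy classes and the derived subgroup -/

lemma Matrix.eq_zero_of_commute_of_apply_eq_zero {n : ℕ} [NeZero n] {K : Type*} [Field K]
    {M : Matrix (Fin n) (Fin n) K} (hM : ∀ N, Commute N M) (h0 : M 0 0 = 0) : M = 0 := by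
  obtain ⟨c, rfl⟩ := Matrix.mem_range_scalar_of_commute_transvectionStruct
    (M := M) fun t => hM _
  have : c = 0 := by simpa using h0
  rw [this, map_zero]

lemma card_monoidHom_units_eq_index_commutator (G : Type*) [Group G] [Finite G] :
    Nat.card (G →* ℂˣ) = (commutator G).index := by
  rw [Nat.card_congr (Abelianization.lift (G := G) (A := ℂˣ))]
  have : NeZero ((Monoid.exponent (Abelianization G) : ℕ) : ℂ) :=
    ⟨Nat.cast_ne_zero.2 Monoid.exponent_ne_zero_of_finite⟩
  exact CommGroup.card_monoidHom_of_hasEnoughRootsOfUnity (Abelianization G) ℂ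

section ClassCount

variable {G : Type*} [Group G] [Fintype G]

/-- The element `∑ φ(g) g` of the group algebra attached to a function `φ` on conjugacy classes. -/
noncomputable def classSum (φ : ConjClasses G → ℂ) : MonoidAlgebra ℂ G :=
  ∑ g : G, MonoidAlgebra.single g (φ (ConjClasses.mk g))

lemma classSum_smul (r : ℂ) (φ : ConjClasses G → ℂ) : classSum (r • φ) = r • classSum φ := by
  simp [classSum, Finset.smul_sum]

lemma classSum_commute_of (φ : ConjClasses G → ℂ) (h : G) :
    Commute (MonoidAlgebra.of ℂ G h) (classSum φ) := by
  rw [Commute, SemiconjBy, classSum, Finset.mul_sum, Finset.sum_mul]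
  refine Fintype.sum_equiv (MulAut.conj h).toEquiv _ _ fun g => ?_
  have : ConjClasses.mk (h * g * h⁻¹) = ConjClasses.mk g :=
    ConjClasses.mk_eq_mk_iff_isConj.2 (isConj_iff.2 ⟨h⁻¹, by group⟩)
  simp [MonoidAlgebra.single_mul_single, this]

lemma classSum_commute (φ : ConjClasses G → ℂ) (a : MonoidAlgebra ℂ G) :
    Commute a (classSum φ) := by
  induction a using MonoidAlgebra.induction_on with
  | of g => exact classSum_commute_of φ g
  | add a b ha hb => exact ha.add_left hb
  | smul r a ha => exact ha.smul_left r

lemma classSum_eq_zero {φ : ConjClasses G → ℂ} (h : classSum φ = 0) : φ = 0 := by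
  classical
  ext c
  obtain ⟨g, rfl⟩ := ConjClasses.mk_surjective c
  have := congrArg (fun f : MonoidAlgebra ℂ G => f.coeff g) h
  simpa [classSum, Finsupp.single_apply] using this

variable (G)

/-- The sum of squares of the degrees of the irreducible representations is `|G|`, and at most
`[G : G']` of these degrees equal `1`. The remaining ones are at least `2`. -/
theorem four_mul_card_conjClasses_le :
    4 * Nat.card (ConjClasses G) ≤ Nat.card G + 3 * (commutator G).index := by
  classical
  have : NeZero (Nat.card G : ℂ) := ⟨Nat.cast_ne_zero.2 Nat.card_pos.ne'⟩
  obtain ⟨n, d, hd, ⟨e⟩⟩ :=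
    IsSemisimpleRing.exists_algEquiv_pi_matrix_of_isAlgClosed ℂ (MonoidAlgebra ℂ G)
  -- Evaluation at a corner is injective on the centre, whose elements are tuples of scalars.
  have hk : Nat.card (ConjClasses G) ≤ n := by
    let F : (ConjClasses G → ℂ) →ₗ[ℂ] (Fin n → ℂ) :=
      { toFun := fun φ i => e (classSum φ) i 0 0
        map_add' := fun φ ψ => by
          ext i; simp [classSum, Finset.sum_add_distrib]
        map_smul' := fun r φ => by
          ext i; simp [classSum_smul] }
    have hF : Function.Injective F := by
      rw [injective_iff_map_eq_zero]
      intro φ hφ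
      apply classSum_eq_zero
      apply e.injective
      rw [map_zero]
      ext1 i
      refine Matrix.eq_zero_of_commute_of_apply_eq_zero (fun N => ?_) (congrFun hφ i)
      have h1 := (classSum_commute φ (e.symm (Pi.single i N))).map e
      rw [AlgEquiv.apply_symm_apply] at h1
      simpa [Commute, SemiconjBy] using congrFun h1 i
    have := LinearMap.finrank_le_finrank_of_injective hF
    simpa [Nat.card_eq_fintype_card] using this
  have hG : Nat.card G = ∑ i, d i ^ 2 := by
    have := e.toLinearEquiv.finrank_eq
    rw [Module.finrank_pi_fintype] at this
    simp only [Module.finrank_matrix, Fintype.card_fin, Module.finrank_self, mul_one] at this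
    rw [← Module.finrank_eq_nat_card_basis (MonoidAlgebra.basis G ℂ)] 
    rw [this]
    exact Finset.sum_congr rfl fun i _ => (sq (d i)).symm
  -- The determinant of a one-dimensional block is a linear character.
  have h1 : (Finset.univ.filter fun i => d i = 1).card ≤ (commutator G).index := by
    let χ : Fin n → (G →* ℂˣ) := fun i => MonoidHom.toHomUnits
      (Matrix.detMonoidHom.comp
        (((Pi.evalMonoidHom (fun i => Matrix (Fin (d i)) (Fin (d i)) ℂ) i).comp
        (e : MonoidAlgebra ℂ G →* _)).comp (MonoidAlgebra.of ℂ G)))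
    have hdet : ∀ i, d i = 1 → ∀ N : Matrix (Fin (d i)) (Fin (d i)) ℂ, N.det = N 0 0 := by
      intro i hi N
      have : Subsingleton (Fin (d i)) := by rw [hi]; infer_instance
      exact Matrix.det_eq_elem_of_subsingleton N 0
    have hinj : Set.InjOn χ {i | d i = 1} := by
      intro i hi j hj hij
      by_contra hne
      let L : (i : Fin n) → MonoidAlgebra ℂ G →ₗ[ℂ] ℂ := fun i =>
        { toFun := fun a => e a i 0 0
          map_add' := by simp
          map_smul' := by simp }
      have hL : L i = L j := by
        refine (MonoidAlgebra.basis G ℂ).ext fun g => ?_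
        have h := congrArg (fun f : G →* ℂˣ => (f g : ℂ)) hij
        simp only [χ, MonoidHom.coe_toHomUnits] at h
        have h' : (e (MonoidAlgebra.of ℂ G g) i).det = (e (MonoidAlgebra.of ℂ G g) j).det := h
        rw [hdet i hi, hdet j hj] at h'
        simpa [L] using h'
      have := congrArg (fun f => f (e.symm (Pi.single i 1))) hL
      simp [L, Ne.symm hne] at this
    rw [← card_monoidHom_units_eq_index_commutator, ← Set.ncard_coe_finset]
    have : Finite (G →* ℂˣ) := Nat.finite_of_card_ne_zero (by
      rw [card_monoidHom_units_eq_index_commutator]; exact Subgroup.index_ne_zero_of_finite)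
    rw [← Set.ncard_univ]
    refine Set.ncard_le_ncard_of_injOn χ (fun _ _ => Set.mem_univ _) ?_
    simpa using hinj
  have h2 : 4 * n ≤ ∑ i, d i ^ 2 + 3 * (Finset.univ.filter fun i => d i = 1).card := by
    rw [Finset.card_filter, Finset.mul_sum, ← Finset.sum_add_distrib]
    calc 4 * n = ∑ _i : Fin n, 4 := by simp [mul_comm]
      _ ≤ _ := Finset.sum_le_sum fun i _ => by
        have := Nat.pos_of_ne_zero (hd i).out
        split_ifs with h
        · simp [h]
        · have : 2 ≤ d i := by omega
          nlinarith
  omega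

end ClassCount

/-! ### Commuting pairs and the centre -/

section Pairs

variable (G : Type*) [Group G] [Finite G]

/-- Whether two elements commute depends only on their cosets modulo the centre, so the number of
commuting pairs is a multiple of `|Z(G)|²`. -/
lemma exists_nat_eq_commProb_mul_index_center_sq :
    ∃ k : ℕ, commProb G * ((Subgroup.center G).index : ℚ) ^ 2 = k := by
  set Z := Subgroup.center G
  let S : Set (G × G) := {p | Commute p.1 p.2}
  let π : G × G → (G × G) ⧸ Z.prod Z := QuotientGroup.mk
  have hS : π ⁻¹' (π '' S) = S := by
    refine subset_antisymm ?_ (Set.subset_preimage_image _ _)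
    rintro ⟨x, y⟩ ⟨⟨a, b⟩, hab, h⟩
    obtain ⟨hx, hy⟩ := Subgroup.mem_prod.1 (QuotientGroup.eq.1 h)
    have hx' : ∀ g, Commute g (a⁻¹ * x) := Subgroup.mem_center_iff.1 hx
    have hy' : ∀ g, Commute g (b⁻¹ * y) := Subgroup.mem_center_iff.1 hy
    have hab : Commute a b := hab
    have h1 : Commute a (b * (b⁻¹ * y)) := hab.mul_right (hy' a)
    rw [mul_inv_cancel_left] at h1
    have h2 : Commute (a * (a⁻¹ * x)) y := h1.mul_left (hx' y).symm
    rwa [mul_inv_cancel_left] at h2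
  have hcard : Nat.card S = Nat.card Z ^ 2 * Nat.card (π '' S) := by
    rw [← hS, Nat.card_congr (QuotientGroup.preimageMkEquivSubgroupProdSet _ _), Nat.card_prod,
      Nat.card_congr (Z.prodEquiv Z).toEquiv, Nat.card_prod, hS, sq]
  refine ⟨Nat.card (π '' S), ?_⟩
  have hZ : (Nat.card Z : ℚ) ≠ 0 := Nat.cast_ne_zero.2 Nat.card_pos.ne'
  have hm : (Z.index : ℚ) ≠ 0 := Nat.cast_ne_zero.2 Subgroup.index_ne_zero_of_finite
  have hS' : (Nat.card { p : G × G // Commute p.1 p.2 } : ℚ)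
      = Nat.card Z ^ 2 * Nat.card (π '' S) := mod_cast hcard
  rw [commProb_def, hS', ← Z.card_mul_index]
  push_cast
  field_simp

/-- `Pr(G) = (1 / [G : Z(G)]) (1 + ([G : Z(G)] - 1) / p)` if every non-central element has exactly
`p` conjugates. -/
lemma commProb_mul_index_center_of_index_centralizer {p : ℕ}
    (h : ∀ x ∉ Subgroup.center G, (Subgroup.centralizer {x}).index = p) :
    commProb G * p * (Subgroup.center G).index + 1 = p + (Subgroup.center G).index := by
  classical
  have := Fintype.ofFinite G
  set Z := Subgroup.center G
  have hpairs : Nat.card { q : G × G // Commute q.1 q.2 }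
      = ∑ x : G, Nat.card (Subgroup.centralizer {x}) := by
    rw [Nat.card_congr (Equiv.subtypeProdEquivSigmaSubtype fun x y : G => Commute x y),
      Nat.card_sigma]
    refine Finset.sum_congr rfl fun x _ => Nat.card_congr (Equiv.subtypeEquivRight fun y => ?_)
    rw [Subgroup.mem_centralizer_singleton_iff]
    exact ⟨fun h => h.eq.symm, fun h => h.symm⟩
  have hterm : ∀ x : G, (p * Nat.card (Subgroup.centralizer {x}) : ℚ)
      = Nat.card G + if x ∈ Z then (p - 1) * (Nat.card G : ℚ) else 0 := by
    intro x
    split_ifs with hx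
    · have : Subgroup.centralizer {x} = ⊤ := by
        rw [Subgroup.centralizer_eq_top_iff_subset]
        simpa using hx
      rw [this, Subgroup.card_top]
      ring
    · rw [add_zero, ← h x hx, ← (Subgroup.centralizer {x}).card_mul_index]
      push_cast
      ring
  have hsum : (p * Nat.card { q : G × G // Commute q.1 q.2 } : ℚ)
      = Nat.card G * Nat.card G + Nat.card Z * ((p - 1) * Nat.card G) := by
    rw [hpairs]
    push_cast
    rw [Finset.mul_sum, Finset.sum_congr rfl fun x _ => hterm x, Finset.sum_add_distrib,
      ← Finset.sum_filter, Finset.sum_const, Finset.sum_const, nsmul_eq_mul, nsmul_eq_mul,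
      Finset.card_univ, ← Nat.card_eq_fintype_card, ← Fintype.card_subtype,
      ← Nat.card_eq_fintype_card]
  have hZ : (Nat.card Z : ℚ) ≠ 0 := Nat.cast_ne_zero.2 Nat.card_pos.ne'
  have hm : (Z.index : ℚ) ≠ 0 := Nat.cast_ne_zero.2 Subgroup.index_ne_zero_of_finite
  have hG : (Nat.card G : ℚ) = Nat.card Z * Z.index := mod_cast Z.card_mul_index.symm
  rw [hG] at hsum
  rw [commProb_def, hG]
  field_simp
  linear_combination hsum

end Pairs

/-! ### Derived subgroup of prime order -/

section PrimeDerived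

variable {G : Type*} [Group G]

lemma commutatorElement_mem_commutator (x y : G) : ⁅x, y⁆ ∈ commutator G :=
  Subgroup.commutator_mem_commutator (Subgroup.mem_top x) (Subgroup.mem_top y)

lemma Subgroup.le_of_mem_of_card_prime {H K : Subgroup G} (hH : (Nat.card H).Prime) {c : G}
    (hcH : c ∈ H) (hcK : c ∈ K) (hc : c ≠ 1) : H ≤ K := by
  have := Fact.mk hH
  rcases (K.subgroupOf H).eq_bot_or_eq_top_of_prime_card with h | h
  · have : (⟨c, hcH⟩ : H) ∈ K.subgroupOf H := hcK
    rw [h, Subgroup.mem_bot] at this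
    exact absurd (congrArg Subtype.val this) hc
  · exact Subgroup.subgroupOf_eq_top.1 h

lemma index_centralizer_of_commutator_le_center (hp : (Nat.card (commutator G)).Prime)
    (hZ : commutator G ≤ Subgroup.center G) {x : G} (hx : x ∉ Subgroup.center G) :
    (Subgroup.centralizer {x}).index = Nat.card (commutator G) := by
  have : Finite (commutator G) := Nat.finite_of_card_ne_zero hp.ne_zero
  let φ : G →* commutator G := MonoidHom.mk'
    (fun g => ⟨⁅x, g⁆, commutatorElement_mem_commutator x g⟩)
    fun a b => by
      ext
      have h := Subgroup.mem_center_iff.1 (hZ (commutatorElement_mem_commutator x b)) a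
      calc ⁅x, a * b⁆ = ⁅x, a⁆ * (a * ⁅x, b⁆ * a⁻¹) := by simp only [commutatorElement_def]; group
        _ = ⁅x, a⁆ * ⁅x, b⁆ := by rw [h, mul_inv_cancel_right]
  have hφ : φ.ker = Subgroup.centralizer {x} := by
    ext g
    rw [MonoidHom.mem_ker, Subgroup.mem_centralizer_singleton_iff, Subtype.ext_iff]
    change ⁅x, g⁆ = 1 ↔ _
    rw [commutatorElement_eq_one_iff_mul_comm]
    exact eq_comm
  rw [← hφ, Subgroup.index_ker]
  refine (hp.eq_one_or_self_of_dvd _ (Subgroup.card_subgroup_dvd_card _)).resolve_left fun h => ?_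
  rw [← Subgroup.index_ker, hφ, Subgroup.index_eq_one,
    Subgroup.centralizer_eq_top_iff_subset] at h
  exact hx (by simpa using h)

/-- If every proper centralizer has index `p` and `[G : Z(G)] = p²`, each of them is the least
subgroup containing the centre and any one of its non-central elements. -/
lemma commute_trans_of_index_centralizer {p : ℕ} (hp : p.Prime)
    (hC : ∀ x ∉ Subgroup.center G, (Subgroup.centralizer {x}).index = p)
    (hm : (Subgroup.center G).index = p ^ 2) {y : G} (hy : y ∉ Subgroup.center G) {x z : G}
    (hxy : Commute x y) (hyz : Commute y z) : Commute x z := by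
  set Z := Subgroup.center G
  by_cases hx : x ∈ Z
  · exact (Subgroup.mem_center_iff.1 hx z).symm
  have hZC : ∀ w : G, Z ≤ Subgroup.centralizer {w} := fun w => Subgroup.center_le_centralizer _
  have hrel : Z.relIndex (Subgroup.centralizer {y}) = p := by
    have := Subgroup.relIndex_mul_index (hZC y)
    rw [hC y hy, hm, sq] at this
    exact Nat.eq_of_mul_eq_mul_right hp.pos this
  let K := Subgroup.centralizer {y} ⊓ Subgroup.centralizer {x}
  have hyK : y ∈ K := ⟨Subgroup.mem_centralizer_singleton_iff.2 rfl,
    Subgroup.mem_centralizer_singleton_iff.2 hxy.eq.symm⟩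
  have hmul : Z.relIndex K * K.relIndex (Subgroup.centralizer {y}) = p := by
    rw [← hrel]
    exact Subgroup.relIndex_mul_relIndex _ _ _ (le_inf (hZC y) (hZC x)) inf_le_left
  rcases hp.eq_one_or_self_of_dvd _ (Dvd.intro_left _ hmul) with h | h
  · have hz : z ∈ K := Subgroup.relIndex_eq_one.1 h
      (Subgroup.mem_centralizer_singleton_iff.2 hyz.eq.symm)
    have : z * x = x * z := Subgroup.mem_centralizer_singleton_iff.1 hz.2
    exact this.symm
  · rw [h] at hmul
    have h1 : Z.relIndex K = 1 := Nat.eq_of_mul_eq_mul_right hp.pos (by rw [hmul, one_mul])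
    exact absurd (Subgroup.relIndex_eq_one.1 h1 hyK) hy

/-- Conjugation by `t` moves elements of `C(G')` by factors in `G'`, hence fixes their commutators;
so these are central in `G`. -/
lemma commute_of_mem_centralizer_commutator (hp : (Nat.card (commutator G)).Prime)
    (hZ : ¬ commutator G ≤ Subgroup.center G) {x g : G}
    (hx : x ∈ Subgroup.centralizer (commutator G : Set G))
    (hg : g ∈ Subgroup.centralizer (commutator G : Set G)) : Commute x g := by
  by_contra hne
  refine hZ (Subgroup.le_of_mem_of_card_prime hp (commutatorElement_mem_commutator x g)
    (Subgroup.mem_center_iff.2 fun t => ?_)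
    fun h => hne (commutatorElement_eq_one_iff_commute.1 h))
  have := Fact.mk hp
  have hcomm : ∀ u ∈ commutator G, ∀ v ∈ commutator G, Commute u v := fun u hu v hv => by
    have : IsCyclic (commutator G) := isCyclic_of_prime_card rfl
    have := IsCyclic.isMulCommutative (α := commutator G) |>.is_comm.comm ⟨u, hu⟩ ⟨v, hv⟩
    exact congrArg Subtype.val this
  have hC : ∀ {w : G}, w ∈ Subgroup.centralizer (commutator G : Set G) →
      ∀ u ∈ commutator G, Commute u w := fun hw u hu => Subgroup.mem_centralizer_iff.1 hw u hu
  set u := ⁅t, x⁆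
  set v := ⁅t, g⁆
  have hu : u ∈ commutator G := commutatorElement_mem_commutator t x
  have hv : v ∈ commutator G := commutatorElement_mem_commutator t g
  have h1 : t * x * t⁻¹ = u * x := by simp [u, commutatorElement_def]
  have h2 : t * g * t⁻¹ = v * g := by simp [v, commutatorElement_def]
  have h3 : t * ⁅x, g⁆ * t⁻¹ = ⁅u * x, v * g⁆ := by
    rw [← h1, ← h2]; simp only [commutatorElement_def]; group
  have h4 : u * x * (v * g) = (u * v) * (x * g) := by
    rw [mul_assoc, ← mul_assoc x, ← (hC hx v hv).eq]; group
  have h5 : v * g * (u * x) = (u * v) * (g * x) := by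
    rw [mul_assoc, ← mul_assoc g, ← (hC hg u hu).eq, (hcomm u hu v hv).eq]; group
  have h6 : ⁅u * x, v * g⁆ = (u * v) * ⁅x, g⁆ * (u * v)⁻¹ := by
    have e1 : ⁅u * x, v * g⁆ = (u * x * (v * g)) * (v * g * (u * x))⁻¹ := by
      simp only [commutatorElement_def]; group
    rw [e1, h4, h5]; simp only [commutatorElement_def]; group
  have h7 : Commute (u * v) ⁅x, g⁆ :=
    hcomm _ (mul_mem hu hv) _ (commutatorElement_mem_commutator x g)
  rw [h6, h7.eq, mul_inv_cancel_right] at h3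
  exact mul_inv_eq_iff_eq_mul.1 h3

/-- The centralizer of a non-central `y` either meets `G'` trivially, so that its commutators
vanish, or contains `G'`. In the second case an element `s` of it outside the abelian group `C(G')`
would centralize all commutators `⁅t, y⁆`, while it centralizes no non-trivial element of `G'`. -/
lemma commute_trans_of_not_commutator_le_center (hp : (Nat.card (commutator G)).Prime)
    (hZ : ¬ commutator G ≤ Subgroup.center G) {y : G} (hy : y ∉ Subgroup.center G) {x z : G}
    (hxy : Commute x y) (hyz : Commute y z) : Commute x z := by
  by_contra hne
  have hmem : ∀ {s : G}, Commute s y → s ∈ Subgroup.centralizer {y} := fun h =>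
    Subgroup.mem_centralizer_singleton_iff.2 h.eq
  have hle : commutator G ≤ Subgroup.centralizer {y} :=
    Subgroup.le_of_mem_of_card_prime hp (commutatorElement_mem_commutator x z)
      (by
        have hx := hmem hxy
        have hz := hmem hyz.symm
        rw [commutatorElement_def]
        exact mul_mem (mul_mem (mul_mem hx hz) (inv_mem hx)) (inv_mem hz))
      fun h => hne (commutatorElement_eq_one_iff_commute.1 h)
  have hyC : y ∈ Subgroup.centralizer (commutator G : Set G) :=
    Subgroup.mem_centralizer_iff.2 fun u hu =>
      Subgroup.mem_centralizer_singleton_iff.1 (hle hu)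
  have hsC : ∀ s : G, Commute s y → s ∈ Subgroup.centralizer (commutator G : Set G) := by
    intro s hs
    by_contra hsC
    refine hy (Subgroup.mem_center_iff.2 fun t => ?_)
    by_contra hty
    refine hsC (Subgroup.mem_centralizer_iff.2 fun u hu => ?_)
    refine Subgroup.mem_centralizer_singleton_iff.1
      (Subgroup.le_of_mem_of_card_prime (K := Subgroup.centralizer {s}) hp
      (commutatorElement_mem_commutator t y) (Subgroup.mem_centralizer_singleton_iff.2 ?_)
      (fun h => hty (commutatorElement_eq_one_iff_mul_comm.1 h)) hu)
    -- `s t = w t s` with `w ∈ G'`, and `w` commutes with the conjugate `t y t⁻¹`.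
    set w := ⁅s, t⁆
    have hw : w ∈ commutator G := commutatorElement_mem_commutator s t
    have hwy : Commute w (t * y * t⁻¹) := by
      have : (Subgroup.centralizer (commutator G : Set G)).Normal := inferInstance
      exact Subgroup.mem_centralizer_iff.1 (this.conj_mem y hyC t) w hw
    have h1 : s * (t * y * t⁻¹) * s⁻¹ = t * y * t⁻¹ := by
      calc s * (t * y * t⁻¹) * s⁻¹ = w * (t * (s * y * s⁻¹) * t⁻¹) * w⁻¹ := by
            simp only [w, commutatorElement_def]; group
        _ = t * y * t⁻¹ := by rw [hs.eq, mul_inv_cancel_right, hwy.eq, mul_inv_cancel_right]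
    have h2 : Commute s (t * y * t⁻¹) := mul_inv_eq_iff_eq_mul.1 h1
    have h3 : Commute s ⁅t, y⁆ := by
      rw [commutatorElement_def]
      exact h2.mul_right hs.inv_right
    exact h3.eq.symm
  exact hne (commute_of_mem_centralizer_commutator hp hZ (hsC x hxy) (hsC z hyz.symm))

end PrimeDerived

/-! ### Prime divisors of the index of the centre -/

section CenterIndex

variable {G : Type*} [Group G]

lemma index_centralizer_dvd_factorial_card (H : Subgroup G) [H.Normal] [Finite H] :
    (Subgroup.centralizer (H : Set G)).index ∣ (Nat.card H).factorial := by
  classical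
  let f : G →* Equiv.Perm H := (MulAut.toPerm H).comp MulAut.conjNormal
  have hf : f.ker = Subgroup.centralizer (H : Set G) := by
    ext g
    rw [MonoidHom.mem_ker, Equiv.ext_iff, Subgroup.mem_centralizer_iff, Subtype.forall]
    refine forall₂_congr fun h hh => ?_
    rw [Subtype.ext_iff]
    change g * h * g⁻¹ = h ↔ h * g = g * h
    rw [mul_inv_eq_iff_eq_mul]
    exact eq_comm
  rw [← hf, Subgroup.index_ker, ← Nat.card_perm]
  exact Subgroup.card_subgroup_dvd_card _

lemma pow_card_commutator_mem_center [Finite G] {x : G}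
    (hx : x ∈ Subgroup.centralizer (commutator G : Set G)) :
    x ^ Nat.card (commutator G) ∈ Subgroup.center G := by
  refine Subgroup.mem_center_iff.2 fun g => ?_
  have hc := commutatorElement_mem_commutator g x
  have h1 : g * x * g⁻¹ = ⁅g, x⁆ * x := by simp [commutatorElement_def]
  have h2 : Commute ⁅g, x⁆ x := Subgroup.mem_centralizer_iff.1 hx _ hc
  have h3 : ⁅g, x⁆ ^ Nat.card (commutator G) = 1 :=
    congrArg Subtype.val (pow_card_eq_one' (x := (⟨_, hc⟩ : commutator G)))
  rw [← mul_inv_eq_iff_eq_mul, ← conj_pow, h1, h2.mul_pow, h3, one_mul]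

lemma dvd_card_commutator_of_dvd_relIndex_center [Finite G] {q : ℕ} (hq : q.Prime)
    (h : q ∣ (Subgroup.center G).relIndex (Subgroup.centralizer (commutator G : Set G))) :
    q ∣ Nat.card (commutator G) := by
  have := Fact.mk hq
  set C := Subgroup.centralizer (commutator G : Set G)
  rw [Subgroup.relIndex, Subgroup.index_eq_card] at h
  obtain ⟨y, hy⟩ := exists_prime_orderOf_dvd_card' q h
  obtain ⟨x, rfl⟩ := QuotientGroup.mk_surjective y
  rw [← hy]
  refine orderOf_dvd_of_pow_eq_one ?_
  rw [← QuotientGroup.mk_pow, QuotientGroup.eq_one_iff, Subgroup.mem_subgroupOf]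
  exact pow_card_commutator_mem_center x.2

/-- `G / C(G')` acts faithfully on `G'`, and `C(G') / Z(G)` has exponent dividing `|G'|`. -/
lemma exists_index_center_eq_mul [Finite G] :
    ∃ a b : ℕ, (Subgroup.center G).index = a * b ∧ a ∣ (Nat.card (commutator G)).factorial ∧
      ∀ q : ℕ, q.Prime → q ∣ b → q ∣ Nat.card (commutator G) := by
  refine ⟨_, _, ?_, index_centralizer_dvd_factorial_card (commutator G),
    fun q hq h => dvd_card_commutator_of_dvd_relIndex_center hq h⟩
  rw [mul_comm, Subgroup.relIndex_mul_index (Subgroup.center_le_centralizer _)]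

end CenterIndex

/-! ### The given commutativity degrees -/

section Values

variable (G : Type*) [Group G] [Finite G]

lemma commProb_mul_card_commutator_le :
    commProb G * (4 * Nat.card (commutator G)) ≤ Nat.card (commutator G) + 3 := by
  have := Fintype.ofFinite G
  have h : (4 * Nat.card (ConjClasses G) : ℚ) ≤ Nat.card G + 3 * (commutator G).index :=
    mod_cast four_mul_card_conjClasses_le G
  have hd : (0 : ℚ) < Nat.card (commutator G) := Nat.cast_pos.2 Nat.card_pos
  have hi : (0 : ℚ) < (commutator G).index :=
    Nat.cast_pos.2 (Nat.pos_of_ne_zero Subgroup.index_ne_zero_of_finite)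
  rw [commProb_def', ← (commutator G).card_mul_index]
  rw [← (commutator G).card_mul_index] at h
  push_cast at h ⊢
  rw [div_mul_eq_mul_div, div_le_iff₀ (by positivity)]
  nlinarith

lemma card_commutator_ne_one_of_commProb_ne_one (h : commProb G ≠ 1) :
    Nat.card (commutator G) ≠ 1 := by
  refine fun h1 => h (commProb_eq_one_iff.2 ⟨⟨fun a b => ?_⟩⟩)
  have := commutatorElement_mem_commutator a b
  rw [Subgroup.card_eq_one.1 h1, Subgroup.mem_bot] at this
  exact commutatorElement_eq_one_iff_mul_comm.1 this

variable {G}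

lemma commProb_ne_of_card_commutator_eq_four (h : Nat.card (commutator G) = 4) :
    commProb G ≠ 5 / 14 ∧ commProb G ≠ 2 / 5 ∧ commProb G ≠ 11 / 27 := by
  obtain ⟨a, b, hm, ha, hb⟩ := exists_index_center_eq_mul (G := G)
  obtain ⟨k, hk⟩ := exists_nat_eq_commProb_mul_index_center_sq G
  rw [h] at ha hb
  rw [show Nat.factorial 4 = 24 from rfl] at ha
  have hq : ∀ q : ℕ, q.Prime → ¬ q ∣ 24 → ¬ q ∣ (Subgroup.center G).index := by
    intro q hq h24 hdvd
    rw [hm] at hdvd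
    rcases hq.dvd_mul.1 hdvd with h | h
    · exact h24 (h.trans ha)
    · exact h24 ((hb q hq h).trans (by norm_num))
  set m := (Subgroup.center G).index
  refine ⟨fun hP => ?_, fun hP => ?_, fun hP => ?_⟩ <;> rw [hP] at hk <;> field_simp at hk <;>
    norm_cast at hk
  · exact hq 7 (by norm_num) (by norm_num)
      (Nat.Prime.dvd_of_dvd_pow (n := 2) (by norm_num) (by omega))
  · exact hq 5 (by norm_num) (by norm_num)
      (Nat.Prime.dvd_of_dvd_pow (n := 2) (by norm_num) (by omega))
  · -- `27 ∣ m²` forces `9 ∣ m = a b`, but `b` is prime to `3` and `9 ∤ 24`.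
    have h3 : 3 ∣ m := Nat.Prime.dvd_of_dvd_pow (n := 2) (by norm_num) (by omega)
    obtain ⟨l, hl⟩ := h3
    rw [hl] at hk
    have h3l : 3 ∣ l := Nat.Prime.dvd_of_dvd_pow (n := 2) (by norm_num) (by
      rw [mul_pow] at hk; omega)
    have h9 : 9 ∣ a * b := by rw [← hm]; omega
    have hcop : Nat.Coprime 9 b := by
      rw [show 9 = 3 ^ 2 by norm_num]
      refine Nat.Coprime.pow_left 2 ((Nat.Prime.coprime_iff_not_dvd (by norm_num)).2 fun h => ?_)
      exact absurd (hb 3 (by norm_num) h) (by norm_num)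
    exact absurd ((hcop.dvd_of_dvd_mul_right h9).trans ha) (by norm_num)

lemma commProb_ne_of_card_commutator_eq_six (h : Nat.card (commutator G) = 6) :
    commProb G ≠ 5 / 14 := by
  obtain ⟨a, b, hm, ha, hb⟩ := exists_index_center_eq_mul (G := G)
  obtain ⟨k, hk⟩ := exists_nat_eq_commProb_mul_index_center_sq G
  rw [h] at ha hb
  rw [show Nat.factorial 6 = 720 from rfl] at ha
  intro hP
  rw [hP] at hk
  field_simp at hk
  norm_cast at hk
  have h7 : 7 ∣ (Subgroup.center G).index :=
    Nat.Prime.dvd_of_dvd_pow (n := 2) (by norm_num) (by omega)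
  rw [hm] at h7
  rcases (Nat.Prime.dvd_mul (by norm_num)).1 h7 with h | h
  · exact absurd (h.trans ha) (by norm_num)
  · exact absurd (hb 7 (by norm_num) h) (by norm_num)

lemma prime_card_commutator_of_commProb_mem
    (hG : commProb G ∈ ({5 / 14, 2 / 5, 11 / 27, 1 / 2, 5 / 8} : Set ℚ)) :
    (Nat.card (commutator G)).Prime ∧ Nat.card (commutator G) ≤ 7 := by
  have hle := commProb_mul_card_commutator_le G
  simp only [Set.mem_insert_iff, Set.mem_singleton_iff] at hG
  have h1 := card_commutator_ne_one_of_commProb_ne_one G (by rintro h; norm_num [h] at hG)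
  have h4 := commProb_ne_of_card_commutator_eq_four (G := G)
  have h6 := commProb_ne_of_card_commutator_eq_six (G := G)
  have h0 : 0 < Nat.card (commutator G) := Nat.card_pos
  generalize Nat.card (commutator G) = d at *
  have hd : d ≤ 7 := by
    rcases hG with h | h | h | h | h <;> rw [h] at hle <;>
      exact_mod_cast (show (d : ℚ) ≤ 7 by linarith)
  refine ⟨?_, hd⟩
  interval_cases d
  · exact absurd rfl h1
  · norm_num
  · norm_num
  · obtain ⟨e1, e2, e3⟩ := h4 rfl
    rcases hG with h | h | h | h | h
    · exact absurd h e1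
    · exact absurd h e2
    · exact absurd h e3
    all_goals norm_num [h] at hle
  · norm_num
  · have e1 := h6 rfl
    rcases hG with h | h | h | h | h
    · exact absurd h e1
    all_goals norm_num [h] at hle
  · norm_num

end Values

/-- Solving `Pr(G) p m + 1 = p + m` for `m` in each case, the only solutions divisible by `p` are
`m = 4` for `Pr(G) = 5/8` and `m = 9` for `Pr(G) = 11/27`. -/
lemma index_center_eq_sq_of_commProb_mem {G : Type*} [Group G]
    (hG : commProb G ∈ ({5 / 14, 2 / 5, 11 / 27, 1 / 2, 5 / 8} : Set ℚ)) {p : ℕ} (hp : p.Prime)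
    (hp7 : p ≤ 7) (hdvd : p ∣ (Subgroup.center G).index)
    (h : commProb G * p * (Subgroup.center G).index + 1 = p + (Subgroup.center G).index) :
    (Subgroup.center G).index = p ^ 2 := by
  generalize (Subgroup.center G).index = m at *
  simp only [Set.mem_insert_iff, Set.mem_singleton_iff] at hG
  have := hp.two_le
  interval_cases p <;> try (exfalso; revert hp; norm_num; done)
  all_goals
    rcases hG with hP | hP | hP | hP | hP <;> rw [hP] at h <;> field_simp at h <;>
      norm_cast at h <;> omega

theorem mainTheorem5 (G : Type*) [Group G] [Fintype G]
    (hG : commProb G ∈ ({5 / 14, 2 / 5, 11 / 27, 1 / 2, 5 / 8} : Set ℚ)) :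
    SuperIntegral.IsSuperIntegral G := by
  obtain ⟨hp, hp7⟩ := prime_card_commutator_of_commProb_mem hG
  have hnc : ∃ a : G, a ∉ Subgroup.center G := by
    by_contra! h
    have h1 : commProb G = 1 :=
      commProb_eq_one_iff.2 ⟨⟨fun a b => Subgroup.mem_center_iff.1 (h b) a⟩⟩
    norm_num [h1] at hG
  refine SuperIntegral.isSuperIntegral_of_commute_trans G ?_ ?_
  · obtain ⟨a, ha⟩ := hnc
    simp only [Subgroup.mem_center_iff, not_forall] at ha
    obtain ⟨b, hb⟩ := ha
    exact ⟨b, a, hb⟩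
  · intro y hy x z hxy hyz
    by_cases hZ : commutator G ≤ Subgroup.center G
    · have hC := fun x hx => index_centralizer_of_commutator_le_center (x := x) hp hZ hx
      refine commute_trans_of_index_centralizer hp hC
        (index_center_eq_sq_of_commProb_mem hG hp hp7 ?_
          (commProb_mul_index_center_of_index_centralizer G hC)) hy hxy hyz
      rw [← hC y hy]
      exact Subgroup.index_dvd_of_le (Subgroup.center_le_centralizer _)
    · exact commute_trans_of_not_commutator_le_center hp hZ hy hxy hyz
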